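/- Let $n\ge 1$ and let $A=[a_{ij}]\in\mathbb C^{n\times n}$ have zero diagonal. Let $\mathcal G(A)$ be the digraph on $\{1,\dots,n\}$ with an edge from $j$ to $i$ if and only if $a_{ij}\ne 0$; it is said to have a spanning tree if some vertex has a directed path to every other vertex. Put $d_i=\sum_{j}|a_{ij}|$, $\Delta=\max_i d_i$ (the maximum modulus degree) and $L=\mathrm{diag}(d_1,\dots,d_n)-A$. Let $\mathbb T=\{w\in\mathbb C:|w|=1\}$ and, for $\zeta\in\mathbb T^n$, $D_\zeta=\mathrm{diag}(\zeta)$. The matrix $A$ is called essentially nonnegative if there is $\zeta\in\mathbb T^n$ such that all entries of $D_\zeta^{-1}AD_\zeta$ are real and nonnegative. Let $0<\kappa<1/\Delta$ (with $1/\Delta=+\infty$ if $\Delta=0$) and consider the discrete-time system $$z(k+1)=z(k)-\kappa Lz(k),\qquad k=0,1,2,\dots,\quad z(k)\in\mathbb C^n .$$ It is said to reach complex consensus if for almost every initial state $z(0)\in\mathbb C^n$ (with respect to Lebesgue measure) there is a number $a>0$ such that $\lim_{k\to\infty}|z_i(k)|=a$ for all $i=1,\dots,n$. Then the system reaches complex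 consensus if and only if $A$ is essentially nonnegative and $\mathcal G(A)$ has a spanning tree. In this case there are a vector $\zeta\in\mathbb T^n$ with $L\zeta=0$ and a real vector $\nu\in\mathbb R^n$ with $\nu_i\ge 0$ for all $i$, $\|\nu\|_1=1$ and $\nu^T D_\zeta^{-1}LD_\zeta=0$; and for every such pair $(\zeta,\nu)$, with $\eta=D_\zeta^{-1}\nu$, every solution with arbitrary initial state $z(0)\in\mathbb C^n$ satisfies $$\lim_{k\to\infty}z(k)=(\eta^Tz(0))\,\zeta .$$ -/

import Mathlib

open Filter Topology MeasureTheory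

namespace ComplexConsensus

noncomputable section

/-- The digraph of a complex matrix `A`: there is an edge from `j` to `i` iff `A i j ≠ 0`. -/
def graph {n : ℕ} (A : Matrix (Fin n) (Fin n) ℂ) : Digraph (Fin n) where
  Adj j i := A i j ≠ 0

/-- A digraph has a (directed) spanning tree if some vertex, the root, has a directed path to
every vertex (the path of length zero leads from the root to itself). -/
def HasSpanningTree {V : Type*} (G : Digraph V) : Prop :=
  ∃ r : V, ∀ v : V, Relation.ReflTransGen G.Adj r v

/-- The modulus degree `d_i`, the sum of `|a_ij|` over the neighbours `j` of `i`, i.e. over the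
`j` with `a_ij ≠ 0`; the remaining terms vanish. -/
def modulusDegree {n : ℕ} (A : Matrix (Fin n) (Fin n) ℂ) (i : Fin n) : ℝ :=
  ∑ j, ‖A i j‖

/-- The maximum modulus degree `Δ`. -/
def maxModulusDegree {n : ℕ} [NeZero n] (A : Matrix (Fin n) (Fin n) ℂ) : ℝ :=
  Finset.univ.sup' Finset.univ_nonempty (modulusDegree A)

/-- The complex Laplacian `L = D - A`, with `D` the diagonal matrix of modulus degrees. -/
def laplacian {n : ℕ} (A : Matrix (Fin n) (Fin n) ℂ) : Matrix (Fin n) (Fin n) ℂ :=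
  Matrix.diagonal (fun i => (modulusDegree A i : ℂ)) - A

/-- The diagonal matrix `D_ζ` of a vector `ζ` with entries on the unit circle. -/
def circleDiag {n : ℕ} (ζ : Fin n → Circle) : Matrix (Fin n) (Fin n) ℂ :=
  Matrix.diagonal (fun i => (ζ i : ℂ))

/-- Switching equivalence of the graphs of `A₁` and `A₂`. -/
def SwitchingEquivalent {n : ℕ} (A₁ A₂ : Matrix (Fin n) (Fin n) ℂ) : Prop :=
  ∃ ζ : Fin n → Circle, A₂ = (circleDiag ζ)⁻¹ * A₁ * circleDiag ζ

/-- All entries are real and nonnegative. -/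
def IsNonnegative {n : ℕ} (A : Matrix (Fin n) (Fin n) ℂ) : Prop :=
  ∀ i j, 0 ≤ (A i j).re ∧ (A i j).im = 0

/-- `A` is essentially nonnegative if its graph is switching equivalent to a graph with a
nonnegative adjacency matrix. -/
def EssentiallyNonnegative {n : ℕ} (A : Matrix (Fin n) (Fin n) ℂ) : Prop :=
  ∃ A₁ : Matrix (Fin n) (Fin n) ℂ, SwitchingEquivalent A A₁ ∧ IsNonnegative A₁

/-- `z` is a trajectory of the discrete-time system `z(k+1) = z(k) - κ L z(k)`. -/
def IsTrajectory {n : ℕ} (A : Matrix (Fin n) (Fin n) ℂ) (κ : ℝ) (z : ℕ → Fin n → ℂ) : Prop :=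
  ∀ k, z (k + 1) = z k - (κ : ℂ) • (laplacian A).mulVec (z k)

/-- The discrete-time system reaches complex consensus: for almost every initial state (with
respect to Lebesgue measure on `ℂⁿ`) the moduli of all agents converge to one common positive
number. The exceptional null set is indispensable: the trajectory of the initial state `0`
is `0`, for every system. -/
def ReachesComplexConsensus {n : ℕ} (A : Matrix (Fin n) (Fin n) ℂ) (κ : ℝ) : Prop :=
  ∀ᵐ z₀ : Fin n → ℂ, ∀ z : ℕ → Fin n → ℂ, IsTrajectory A κ z → z 0 = z₀ →
    ∃ a : ℝ, 0 < a ∧ ∀ i, Tendsto (fun k => ‖z k i‖) atTop (𝓝 a)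

/-- `ζ ∈ 𝕋ⁿ` is an eigenvector of the Laplacian for the eigenvalue zero. -/
def IsCircleNullVector {n : ℕ} (A : Matrix (Fin n) (Fin n) ℂ) (ζ : Fin n → Circle) : Prop :=
  (laplacian A).mulVec (fun i => (ζ i : ℂ)) = 0

/-- `ν` is a nonnegative left eigenvector of `D_ζ⁻¹ L D_ζ` for the eigenvalue zero, with
`1`-norm one. -/
def IsNormalizedLeftNullVector {n : ℕ} (A : Matrix (Fin n) (Fin n) ℂ) (ζ : Fin n → Circle)
    (ν : Fin n → ℝ) : Prop :=
  (∀ i, 0 ≤ ν i) ∧ ∑ i, |ν i| = 1 ∧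
    Matrix.vecMul (fun i => (ν i : ℂ)) ((circleDiag ζ)⁻¹ * laplacian A * circleDiag ζ) = 0

/-- The vector `η = D_ζ⁻¹ ν`. -/
def leftVector {n : ℕ} (ζ : Fin n → Circle) (ν : Fin n → ℝ) : Fin n → ℂ :=
  (circleDiag ζ)⁻¹.mulVec (fun i => (ν i : ℂ))

end

end ComplexConsensus

/-!
**Idea.** If `L ζ = 0` with `ζ ∈ 𝕋ⁿ`, equality holds in the triangle inequality of every row, so
`a_ij ζ_j = |a_ij| ζ_i`: switching by `ζ` replaces every weight by its modulus. Hence essential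
nonnegativity means that `L` has a null vector in `𝕋ⁿ`, and switching turns the step matrix
`1 - κ L` into a row stochastic matrix with positive diagonal. If the digraph has a spanning tree,
some power of that matrix has a positive column, hence contracts the spread of every vector, and
the powers converge to the matrix all of whose rows are the stationary distribution. The limit
state vanishes only on the kernel of a nonzero linear functional, a null set.

Conversely, a limit point of a trajectory in consensus is, with its image under the step matrix, a
vector with entries of constant modulus; equality in the triangle inequality makes it a null vector
of `L`. If there were no spanning tree, two vertices would have disjoint sets of ancestors. By the
maximum principle, trajectories that start near `ζ` on one of them and near `0` on the other one
stay there, so that the moduli cannot have a common limit.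
-/

namespace ComplexConsensus

open scoped Matrix

section TriangleInequality

variable {E : Type*} [NormedAddCommGroup E] [NormedSpace ℝ E] [StrictConvexSpace ℝ E]

theorem sameRay_sum_of_norm_sum_eq {ι : Type*} {s : Finset ι} {x : ι → E}
    (h : ‖∑ j ∈ s, x j‖ = ∑ j ∈ s, ‖x j‖) {i : ι} (hi : i ∈ s) :
    SameRay ℝ (x i) (∑ j ∈ s, x j) := by
  classical
  rw [← Finset.add_sum_erase s _ hi] at h ⊢
  rw [← Finset.add_sum_erase s _ hi] at h
  have hrest : ‖∑ j ∈ s.erase i, x j‖ ≤ ∑ j ∈ s.erase i, ‖x j‖ := norm_sum_le _ _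
  have hadd : ‖x i + ∑ j ∈ s.erase i, x j‖ = ‖x i‖ + ‖∑ j ∈ s.erase i, x j‖ :=
    le_antisymm (norm_add_le _ _) (by linarith)
  exact (SameRay.refl _).add_right (sameRay_iff_norm_add.2 hadd)

theorem smul_add_eq_of_norm_eq {w y : E} {t : ℝ} (ht : 0 < t) (hy : ‖y‖ ≤ (1 - t) * ‖w‖)
    (h : ‖t • w + y‖ = ‖w‖) : t • w + y = w := by
  have hadd : ‖t • w + y‖ = ‖t • w‖ + ‖y‖ := by
    refine le_antisymm (norm_add_le _ _) ?_
    rw [h, norm_smul, Real.norm_of_nonneg ht.le]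
    linarith
  have hray : SameRay ℝ (t • w) (t • w + y) :=
    (SameRay.refl _).add_right (sameRay_iff_norm_add.2 hadd)
  exact (((SameRay.sameRay_pos_smul_right w ht).trans hray fun hw =>
    Or.inl ((smul_eq_zero_iff_right ht.ne').1 hw)).eq_of_norm_eq h.symm).symm

end TriangleInequality

section Stochastic

variable {ι : Type*} [Fintype ι] [DecidableEq ι]

theorem eventually_pow_apply_pos {R : Type*} [Semiring R] [PartialOrder R] [IsStrictOrderedRing R]
    {P : Matrix ι ι R} (hP : ∀ i j, 0 ≤ P i j) (hdiag : ∀ i, 0 < P i i) {r v : ι}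
    (h : Relation.ReflTransGen (fun j i => 0 < P i j) r v) : ∀ᶠ m in atTop, 0 < (P ^ m) v r := by
  have hstep : ∀ {m v u}, 0 < P v u → 0 < (P ^ m) u r → 0 < (P ^ (m + 1)) v r := by
    intro m v u hvu hur
    rw [pow_succ', Matrix.mul_apply]
    exact Finset.sum_pos' (fun l _ => mul_nonneg (hP v l) (Matrix.pow_apply_nonneg hP m l r))
      ⟨u, Finset.mem_univ u, mul_pos hvu hur⟩
  obtain ⟨m, hm⟩ : ∃ m, 0 < (P ^ m) v r := by
    induction h with
    | refl => exact ⟨0, by simp⟩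
    | tail _ hvu ih =>
      obtain ⟨m, hm⟩ := ih
      exact ⟨m + 1, hstep hvu hm⟩
  filter_upwards [eventually_ge_atTop m] with k hk
  induction k, hk using Nat.le_induction with
  | base => exact hm
  | succ k _ ih => exact hstep (hdiag v) ih

theorem mulVec_apply_le {R : Type*} [CommRing R] [PartialOrder R] [IsOrderedRing R]
    {Q : Matrix ι ι R} (hQ : Q ∈ Matrix.rowStochastic R ι) {i r : ι} {ε b : R} (hε : ε ≤ Q i r)
    {y : ι → R} (hy : ∀ l, y l ≤ b) : (Q *ᵥ y) i ≤ b - ε * (b - y r) := by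
  have hsum : ∑ l, Q i l * (b - y l) = b - (Q *ᵥ y) i := by
    simp only [mul_sub, Finset.sum_sub_distrib, ← Finset.sum_mul,
      Matrix.sum_row_of_mem_rowStochastic hQ, one_mul, Matrix.mulVec, dotProduct]
  have hle : ε * (b - y r) ≤ b - (Q *ᵥ y) i := calc
    ε * (b - y r) ≤ Q i r * (b - y r) := mul_le_mul_of_nonneg_right hε (sub_nonneg.2 (hy r))
    _ ≤ ∑ l, Q i l * (b - y l) :=
      Finset.single_le_sum (f := fun l => Q i l * (b - y l))
        (fun l _ => mul_nonneg (hQ.1 i l) (sub_nonneg.2 (hy l))) (Finset.mem_univ r)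
    _ = b - (Q *ᵥ y) i := hsum
  exact le_sub_comm.1 hle

theorem mulVec_sub_mulVec_le {Q : Matrix ι ι ℝ} (hQ : Q ∈ Matrix.rowStochastic ℝ ι) {r : ι}
    {ε C : ℝ} (hε : ∀ i, ε ≤ Q i r) {y : ι → ℝ} (hy : ∀ i j, y i - y j ≤ C) (i j : ι) :
    (Q *ᵥ y) i - (Q *ᵥ y) j ≤ (1 - ε) * C := by
  have : Nonempty ι := ⟨r⟩
  obtain ⟨p, hp⟩ := Finite.exists_max y
  obtain ⟨q, hq⟩ := Finite.exists_min y
  have hi : (Q *ᵥ y) i ≤ y p - ε * (y p - y r) := mulVec_apply_le hQ (hε i) hp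
  have hj : (Q *ᵥ (-y)) j ≤ -y q - ε * (-y q - -y r) :=
    mulVec_apply_le hQ (hε j) fun l => neg_le_neg (hq l)
  have hε1 : ε ≤ 1 := (hε r).trans (Matrix.le_one_of_mem_rowStochastic hQ)
  have hC : (1 - ε) * (y p - y q) ≤ (1 - ε) * C :=
    mul_le_mul_of_nonneg_left (hy p q) (sub_nonneg.2 hε1)
  rw [Matrix.mulVec_neg, Pi.neg_apply] at hj
  linarith

theorem pow_mulVec_sub_pow_mulVec_le {Q : Matrix ι ι ℝ} (hQ : Q ∈ Matrix.rowStochastic ℝ ι)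
    {r : ι} {ε C : ℝ} (hε : ∀ i, ε ≤ Q i r) {y : ι → ℝ} (hy : ∀ i j, y i - y j ≤ C) (t : ℕ)
    (i j : ι) : (Q ^ t *ᵥ y) i - (Q ^ t *ᵥ y) j ≤ (1 - ε) ^ t * C := by
  induction t generalizing i j with
  | zero => simpa using hy i j
  | succ t ih =>
    rw [pow_succ', ← Matrix.mulVec_mulVec, pow_succ', mul_assoc]
    exact mulVec_sub_mulVec_le hQ hε ih i j

variable {P : Matrix ι ι ℝ}

theorem tendsto_pow_mulVec_sub_pow_mulVec (hP : P ∈ Matrix.rowStochastic ℝ ι)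
    (hdiag : ∀ i, 0 < P i i) (htree : HasSpanningTree ⟨fun j i => 0 < P i j⟩) (y : ι → ℝ)
    (i j : ι) : Tendsto (fun k => (P ^ k *ᵥ y) i - (P ^ k *ᵥ y) j) atTop (𝓝 0) := by
  obtain ⟨r, hr⟩ := htree
  have : Nonempty ι := ⟨r⟩
  obtain ⟨m, hcol, hm⟩ : ∃ m, (∀ v, 0 < (P ^ m) v r) ∧ 0 < m :=
    ((eventually_all.2 fun v => eventually_pow_apply_pos hP.1 hdiag (hr v)).and
      (eventually_gt_atTop 0)).exists
  obtain ⟨q, hq⟩ := Finite.exists_min fun v => (P ^ m) v r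
  obtain ⟨C, hC⟩ : ∃ C, ∀ i j, y i - y j ≤ C := by
    obtain ⟨b, hb⟩ := Finite.exists_max y
    obtain ⟨a, ha⟩ := Finite.exists_min y
    exact ⟨y b - y a, fun i j => sub_le_sub (hb i) (ha j)⟩
  set ε := (P ^ m) q r
  have hε1 : ε ≤ 1 := Matrix.le_one_of_mem_rowStochastic (pow_mem hP m)
  have hspread : ∀ k i j, (P ^ k *ᵥ y) i - (P ^ k *ᵥ y) j ≤ (1 - ε) ^ (k / m) * C := by
    intro k i j
    have hrem : ∀ i j, (P ^ (k % m) *ᵥ y) i - (P ^ (k % m) *ᵥ y) j ≤ C := fun i j => by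
      simpa using mulVec_sub_mulVec_le (pow_mem hP (k % m)) (r := r) (ε := 0)
        (fun i => (pow_mem hP (k % m)).1 i r) hC i j
    have := pow_mulVec_sub_pow_mulVec_le (pow_mem hP m) hq hrem (k / m) i j
    rwa [Matrix.mulVec_mulVec, ← pow_mul, ← pow_add, Nat.div_add_mod] at this
  have hlim : Tendsto (fun k => (1 - ε) ^ (k / m) * C) atTop (𝓝 0) := by
    simpa using ((tendsto_pow_atTop_nhds_zero_of_lt_one (sub_nonneg.2 hε1)
      (sub_lt_self 1 (hcol q))).comp (Nat.tendsto_div_const_atTop hm.ne')).mul_const C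
  refine squeeze_zero_norm (fun k => abs_sub_le_iff.2 ⟨hspread k i j, hspread k j i⟩) hlim

theorem tendsto_pow_apply_of_vecMul_eq (hP : P ∈ Matrix.rowStochastic ℝ ι)
    (hdiag : ∀ i, 0 < P i i) (htree : HasSpanningTree ⟨fun j i => 0 < P i j⟩) {ν : ι → ℝ}
    (hν : ∑ i, ν i = 1) (hνP : ν ᵥ* P = ν) (i j : ι) :
    Tendsto (fun k => (P ^ k) i j) atTop (𝓝 (ν j)) := by
  have hstat : ∀ k, ν ᵥ* P ^ k = ν := by
    intro k
    induction k with
    | zero => simp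
    | succ k ih => rw [pow_succ, ← Matrix.vecMul_vecMul, ih, hνP]
  have hdiff : ∀ k, ∑ l, ν l * ((P ^ k) i j - (P ^ k) l j) = (P ^ k) i j - ν j := by
    intro k
    have hj : ∑ l, ν l * (P ^ k) l j = ν j := congrFun (hstat k) j
    simp only [mul_sub, Finset.sum_sub_distrib, ← Finset.sum_mul, hν, one_mul, hj]
  have hlim : ∀ l, Tendsto (fun k => ν l * ((P ^ k) i j - (P ^ k) l j)) atTop (𝓝 0) := fun l => by
    simpa using (tendsto_pow_mulVec_sub_pow_mulVec hP hdiag htree (Pi.single j 1) i l).const_mul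
      (ν l)
  rw [← tendsto_sub_nhds_zero_iff]
  simpa only [hdiff, Finset.sum_const_zero] using tendsto_finsetSum Finset.univ fun l _ => hlim l

theorem abs_vecMul_eq (hP : P ∈ Matrix.rowStochastic ℝ ι) {v : ι → ℝ} (hv : v ᵥ* P = v) :
    |v| ᵥ* P = |v| := by
  have hle : ∀ j, |v| j ≤ (|v| ᵥ* P) j := fun j => calc
    |v j| = |∑ i, v i * P i j| := congrArg abs (congrFun hv j).symm
    _ ≤ ∑ i, |v i * P i j| := Finset.abs_sum_le_sum_abs _ _
    _ = ∑ i, |v i| * P i j := by simp only [abs_mul, abs_of_nonneg (hP.1 _ j)]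
  have htotal : ∑ j, |v| j = ∑ j, (|v| ᵥ* P) j := by
    simp only [Matrix.vecMul, dotProduct]
    rw [Finset.sum_comm]
    simp only [← Finset.mul_sum, Matrix.sum_row_of_mem_rowStochastic hP, mul_one]
  exact funext fun j =>
    ((Finset.sum_eq_sum_iff_of_le fun j _ => hle j).1 htotal j (Finset.mem_univ j)).symm

theorem exists_mem_stdSimplex_vecMul_eq [Nonempty ι] (hP : P ∈ Matrix.rowStochastic ℝ ι) :
    ∃ ν ∈ stdSimplex ℝ ι, ν ᵥ* P = ν := by
  have hdet : (P - 1).det = 0 := by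
    refine Matrix.exists_mulVec_eq_zero_iff.1 ⟨1, one_ne_zero, ?_⟩
    rw [Matrix.sub_mulVec, hP.2, Matrix.one_mulVec, sub_self]
  obtain ⟨v, hv0, hv⟩ := Matrix.exists_vecMul_eq_zero_iff.2 hdet
  rw [Matrix.vecMul_sub, Matrix.vecMul_one, sub_eq_zero] at hv
  have hpos : 0 < ∑ j, |v| j := by
    obtain ⟨i, hi⟩ := Function.ne_iff.1 hv0
    exact Finset.sum_pos' (fun _ _ => abs_nonneg _) ⟨i, Finset.mem_univ i, abs_pos.2 hi⟩
  refine ⟨(∑ j, |v| j)⁻¹ • |v|, ⟨fun i => ?_, ?_⟩, ?_⟩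
  · exact mul_nonneg (inv_nonneg.2 hpos.le) (abs_nonneg _)
  · simp only [Pi.smul_apply, smul_eq_mul, ← Finset.mul_sum, inv_mul_cancel₀ hpos.ne']
  · rw [Matrix.smul_vecMul, abs_vecMul_eq hP hv]

end Stochastic

section Digraph

variable {V : Type*} {G H : Digraph V}

theorem HasSpanningTree.mono (hGH : ∀ ⦃u v⦄, G.Adj u v → H.Adj u v) :
    HasSpanningTree G → HasSpanningTree H :=
  Exists.imp fun r hr v => Relation.ReflTransGen.mono hGH r v (hr v)

theorem exists_disjoint_ancestors_of_not_hasSpanningTree [Finite V] [Nonempty V]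
    (h : ¬ HasSpanningTree G) :
    ∃ v w : V, Disjoint {u | Relation.ReflTransGen G.Adj u v}
      {u | Relation.ReflTransGen G.Adj u w} := by
  let ancestors : V → Set V := fun v => {u | Relation.ReflTransGen G.Adj u v}
  obtain ⟨v, hv⟩ := Finite.exists_min fun v => (ancestors v).ncard
  obtain ⟨w, hw⟩ : ∃ w, ¬ Relation.ReflTransGen G.Adj v w := by
    by_contra! hroot
    exact h ⟨v, hroot⟩
  refine ⟨v, w, Set.disjoint_left.2 fun u huv huw => hw ?_⟩
  have hsub : ancestors u ⊆ ancestors v := fun x hx => hx.trans huv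
  have heq : ancestors u = ancestors v := Set.eq_of_subset_of_ncard_le hsub (hv u)
  have hvu : v ∈ ancestors u := heq ▸ .refl
  exact hvu.trans huw

end Digraph

section NullVector

variable {n : ℕ} {A : Matrix (Fin n) (Fin n) ℂ} {ζ : Fin n → Circle}

theorem circleDiag_inv (ζ : Fin n → Circle) : (circleDiag ζ)⁻¹ = circleDiag ζ⁻¹ := by
  refine Matrix.inv_eq_left_inv ?_
  simp [circleDiag, Matrix.diagonal_mul_diagonal]

theorem circleDiag_inv_mul_mul_apply (M : Matrix (Fin n) (Fin n) ℂ) (ζ : Fin n → Circle)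
    (i j : Fin n) : ((circleDiag ζ)⁻¹ * M * circleDiag ζ) i j = (ζ i : ℂ)⁻¹ * M i j * ζ j := by
  rw [circleDiag_inv, circleDiag, circleDiag, Matrix.mul_diagonal, Matrix.diagonal_mul,
    Pi.inv_apply, Circle.coe_inv]

theorem leftVector_apply (ζ : Fin n → Circle) (ν : Fin n → ℝ) (i : Fin n) :
    leftVector ζ ν i = (ζ i : ℂ)⁻¹ * ν i := by
  rw [leftVector, circleDiag_inv, circleDiag, Matrix.mulVec_diagonal, Pi.inv_apply,
    Circle.coe_inv]

theorem laplacian_mulVec_apply (A : Matrix (Fin n) (Fin n) ℂ) (z : Fin n → ℂ) (i : Fin n) :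
    (laplacian A *ᵥ z) i = modulusDegree A i * z i - ∑ j, A i j * z j := by
  rw [laplacian, Matrix.sub_mulVec, Pi.sub_apply, Matrix.mulVec_diagonal]
  rfl

theorem isCircleNullVector_iff :
    IsCircleNullVector A ζ ↔ ∀ i j, A i j * ζ j = ‖A i j‖ * ζ i := by
  have hrow : IsCircleNullVector A ζ ↔ ∀ i, ∑ j, A i j * ζ j = modulusDegree A i * ζ i := by
    rw [IsCircleNullVector, funext_iff]
    refine forall_congr' fun i => ?_
    rw [laplacian_mulVec_apply, Pi.zero_apply, sub_eq_zero, eq_comm]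
  refine hrow.trans ⟨fun h i j => ?_, fun h i => ?_⟩
  · have hnorm : ∀ j, ‖A i j * ζ j‖ = ‖A i j‖ := fun j => by simp [Circle.norm_coe]
    have hdeg : 0 ≤ modulusDegree A i := Finset.sum_nonneg fun _ _ => norm_nonneg _
    have hsum : ‖∑ j, A i j * ζ j‖ = modulusDegree A i := by
      simp [h, Circle.norm_coe, abs_of_nonneg hdeg]
    have hray := sameRay_sum_of_norm_sum_eq (hsum.trans (Finset.sum_congr rfl fun j _ =>
      (hnorm j).symm)) (Finset.mem_univ j)
    have hsmul := hray.norm_smul_eq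
    rw [hsum, hnorm, h] at hsmul
    rcases hdeg.eq_or_lt with h0 | hpos
    · have : ‖A i j‖ ≤ 0 := h0 ▸ Finset.single_le_sum (fun j _ => norm_nonneg (A i j))
        (Finset.mem_univ j)
      simp [norm_le_zero_iff.1 this]
    · refine mul_left_cancel₀ (Complex.ofReal_ne_zero.2 hpos.ne') ?_
      simp only [Complex.real_smul] at hsmul
      linear_combination -hsmul
  · simp only [h, modulusDegree, Complex.ofReal_sum, Finset.sum_mul]

theorem essentiallyNonnegative_iff_exists_isCircleNullVector :
    EssentiallyNonnegative A ↔ ∃ ζ, IsCircleNullVector A ζ := by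
  have hentry : ∀ (ζ : Fin n → Circle) i j, A i j * ζ j = ‖A i j‖ * ζ i ↔
      (ζ i : ℂ)⁻¹ * A i j * ζ j = ‖A i j‖ := fun ζ i j => by
    rw [mul_assoc, inv_mul_eq_iff_eq_mul₀ (Circle.coe_ne_zero _), mul_comm (ζ i : ℂ)]
  simp only [isCircleNullVector_iff, hentry]
  constructor
  · rintro ⟨_, ⟨ζ, rfl⟩, hnonneg⟩
    refine ⟨ζ, fun i j => ?_⟩
    obtain ⟨hre, him⟩ := hnonneg i j
    rw [circleDiag_inv_mul_mul_apply] at hre him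
    have hnorm : ‖(ζ i : ℂ)⁻¹ * A i j * ζ j‖ = ‖A i j‖ := by simp [Circle.norm_coe]
    rw [← hnorm, Complex.norm_eq_sqrt_sq_add_sq, him]
    refine Complex.ext ?_ ?_ <;> simp [Real.sqrt_sq hre, him, -Complex.mul_re]
  · rintro ⟨ζ, hζ⟩
    refine ⟨_, ⟨ζ, rfl⟩, fun i j => ?_⟩
    rw [circleDiag_inv_mul_mul_apply, hζ]
    simp

/-- The real Laplacian `D - |A|` of the weights `|a_ij|`, the form that `laplacian A` takes after
switching by a null vector on the unit circle. -/
noncomputable def modulusLaplacian (A : Matrix (Fin n) (Fin n) ℂ) : Matrix (Fin n) (Fin n) ℝ :=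
  Matrix.diagonal (modulusDegree A) - A.map norm

theorem IsCircleNullVector.inv_mul_laplacian_mul (hζ : IsCircleNullVector A ζ) :
    (circleDiag ζ)⁻¹ * laplacian A * circleDiag ζ =
      (modulusLaplacian A).map Complex.ofRealHom := by
  ext i j
  rw [circleDiag_inv_mul_mul_apply, mul_assoc,
    inv_mul_eq_iff_eq_mul₀ (Circle.coe_ne_zero _)]
  have hij := isCircleNullVector_iff.1 hζ i j
  rcases eq_or_ne i j with rfl | hne
  · simp only [laplacian, modulusLaplacian, Matrix.sub_apply, Matrix.diagonal_apply_eq,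
      Matrix.map_apply, Complex.ofRealHom_eq_coe, Complex.ofReal_sub]
    linear_combination -hij
  · simp only [laplacian, modulusLaplacian, Matrix.sub_apply, Matrix.diagonal_apply_ne _ hne,
      Matrix.map_apply, Complex.ofRealHom_eq_coe, zero_sub, Complex.ofReal_neg]
    linear_combination -hij

theorem IsCircleNullVector.isNormalizedLeftNullVector_iff (hζ : IsCircleNullVector A ζ)
    {ν : Fin n → ℝ} : IsNormalizedLeftNullVector A ζ ν ↔
      ν ∈ stdSimplex ℝ (Fin n) ∧ ν ᵥ* modulusLaplacian A = 0 := by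
  have hmap : (fun i => (ν i : ℂ)) ᵥ* (modulusLaplacian A).map Complex.ofRealHom = 0 ↔
      ν ᵥ* modulusLaplacian A = 0 := by
    simp only [funext_iff, Pi.zero_apply]
    refine forall_congr' fun j => ?_
    rw [← Complex.ofReal_eq_zero]
    exact Eq.congr_left (RingHom.map_vecMul Complex.ofRealHom _ ν j).symm
  rw [IsNormalizedLeftNullVector, hζ.inv_mul_laplacian_mul, hmap, ← and_assoc]
  refine and_congr_left' (and_congr_right fun hν => ?_)
  simp only [abs_of_nonneg (hν _)]

end NullVector

section StepMatrix

variable {n : ℕ} {A : Matrix (Fin n) (Fin n) ℂ} {κ : ℝ} {ζ : Fin n → Circle}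
  {z : ℕ → Fin n → ℂ}

/-- The matrix `1 - κ L`, which maps a state of the discrete-time system to the next one. -/
noncomputable def stepMatrix (A : Matrix (Fin n) (Fin n) ℂ) (κ : ℝ) :
    Matrix (Fin n) (Fin n) ℂ :=
  1 - (κ : ℂ) • laplacian A

/-- The matrix `1 - κ (D - |A|)` of the system with the weights `|a_ij|`; for `0 ≤ κ ≤ 1 / Δ` it
is the transition matrix of a Markov chain. -/
noncomputable def modulusStepMatrix (A : Matrix (Fin n) (Fin n) ℂ) (κ : ℝ) :
    Matrix (Fin n) (Fin n) ℝ :=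
  1 - κ • modulusLaplacian A

theorem stepMatrix_mulVec (A : Matrix (Fin n) (Fin n) ℂ) (κ : ℝ) (w : Fin n → ℂ) :
    stepMatrix A κ *ᵥ w = w - (κ : ℂ) • (laplacian A *ᵥ w) := by
  rw [stepMatrix, Matrix.sub_mulVec, Matrix.one_mulVec, Matrix.smul_mulVec]

theorem stepMatrix_mulVec_apply (A : Matrix (Fin n) (Fin n) ℂ) (κ : ℝ) (w : Fin n → ℂ)
    (i : Fin n) : (stepMatrix A κ *ᵥ w) i =
      (1 - κ * modulusDegree A i) • w i + κ • ∑ j, A i j * w j := by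
  simp only [stepMatrix_mulVec, Pi.sub_apply, Pi.smul_apply, laplacian_mulVec_apply, smul_eq_mul,
    Complex.real_smul, Complex.ofReal_sub, Complex.ofReal_one, Complex.ofReal_mul]
  ring

theorem isTrajectory_iff_forall_pow :
    IsTrajectory A κ z ↔ ∀ k, z k = stepMatrix A κ ^ k *ᵥ z 0 := by
  simp only [IsTrajectory, ← stepMatrix_mulVec]
  refine ⟨fun h k => ?_, fun h k => ?_⟩
  · induction k with
    | zero => simp
    | succ k ih => rw [h, ih, Matrix.mulVec_mulVec, ← pow_succ']
  · rw [h (k + 1), h k, Matrix.mulVec_mulVec, ← pow_succ']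

theorem exists_isTrajectory (A : Matrix (Fin n) (Fin n) ℂ) (κ : ℝ) (z₀ : Fin n → ℂ) :
    ∃ z, IsTrajectory A κ z ∧ z 0 = z₀ :=
  ⟨fun k => stepMatrix A κ ^ k *ᵥ z₀, isTrajectory_iff_forall_pow.2 (by simp), by simp⟩

theorem mul_modulusDegree_lt_one [NeZero n] (hκ : 0 < κ)
    (hκΔ : maxModulusDegree A ≠ 0 → κ < 1 / maxModulusDegree A) (i : Fin n) :
    κ * modulusDegree A i < 1 := by
  have hnonneg : 0 ≤ modulusDegree A i := Finset.sum_nonneg fun _ _ => norm_nonneg _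
  have hle : modulusDegree A i ≤ maxModulusDegree A :=
    Finset.le_sup' (modulusDegree A) (Finset.mem_univ i)
  rcases (hnonneg.trans hle).eq_or_lt with hzero | hpos
  · simp [le_antisymm (hzero ▸ hle) hnonneg]
  · exact (mul_le_mul_of_nonneg_left hle hκ.le).trans_lt ((lt_div_iff₀ hpos).1 (hκΔ hpos.ne'))

theorem modulusStepMatrix_apply (A : Matrix (Fin n) (Fin n) ℂ) (κ : ℝ) (i j : Fin n) :
    modulusStepMatrix A κ i j =
      (if i = j then 1 - κ * modulusDegree A i else 0) + κ * ‖A i j‖ := by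
  simp only [modulusStepMatrix, modulusLaplacian, Matrix.sub_apply, Matrix.smul_apply,
    Matrix.one_apply, Matrix.diagonal_apply, Matrix.map_apply, smul_eq_mul]
  split_ifs <;> ring

theorem modulusStepMatrix_mem_rowStochastic (hκ : 0 ≤ κ)
    (hκd : ∀ i, κ * modulusDegree A i ≤ 1) :
    modulusStepMatrix A κ ∈ Matrix.rowStochastic ℝ (Fin n) := by
  refine Matrix.mem_rowStochastic_iff_sum.2 ⟨fun i j => ?_, fun i => ?_⟩
  · rw [modulusStepMatrix_apply]
    refine add_nonneg ?_ (mul_nonneg hκ (norm_nonneg _))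
    split_ifs
    exacts [sub_nonneg.2 (hκd i), le_rfl]
  · simp only [modulusStepMatrix_apply, Finset.sum_add_distrib, Finset.sum_ite_eq, Finset.mem_univ,
      if_true, ← Finset.mul_sum]
    exact sub_add_cancel _ _

theorem modulusStepMatrix_apply_self_pos (hκ : 0 ≤ κ) (hκd : ∀ i, κ * modulusDegree A i < 1)
    (i : Fin n) : 0 < modulusStepMatrix A κ i i := by
  rw [modulusStepMatrix_apply, if_pos rfl]
  exact add_pos_of_pos_of_nonneg (sub_pos.2 (hκd i)) (mul_nonneg hκ (norm_nonneg _))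

theorem modulusStepMatrix_apply_pos_of_adj (hκ : 0 < κ) (hκd : ∀ i, κ * modulusDegree A i ≤ 1)
    {i j : Fin n} (h : (graph A).Adj j i) : 0 < modulusStepMatrix A κ i j := by
  rw [modulusStepMatrix_apply]
  refine add_pos_of_nonneg_of_pos ?_ (mul_pos hκ (norm_pos_iff.2 h))
  split_ifs
  exacts [sub_nonneg.2 (hκd i), le_rfl]

theorem vecMul_modulusStepMatrix_eq_iff (hκ : κ ≠ 0) {ν : Fin n → ℝ} :
    ν ᵥ* modulusStepMatrix A κ = ν ↔ ν ᵥ* modulusLaplacian A = 0 := by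
  rw [modulusStepMatrix, Matrix.vecMul_sub, Matrix.vecMul_one, Matrix.vecMul_smul, sub_eq_self,
    smul_eq_zero_iff_right hκ]

theorem IsCircleNullVector.semiconjBy_stepMatrix (hζ : IsCircleNullVector A ζ) (κ : ℝ) :
    SemiconjBy (circleDiag ζ) ((modulusStepMatrix A κ).map Complex.ofRealHom)
      (stepMatrix A κ) := by
  have hunit : circleDiag ζ * (circleDiag ζ)⁻¹ = 1 := by
    rw [circleDiag_inv]
    simp [circleDiag, Matrix.diagonal_mul_diagonal]
  have hlap : circleDiag ζ * (modulusLaplacian A).map Complex.ofRealHom =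
      laplacian A * circleDiag ζ := by
    rw [← hζ.inv_mul_laplacian_mul, ← mul_assoc, ← mul_assoc, hunit, one_mul]
  have hmap : (modulusStepMatrix A κ).map Complex.ofRealHom =
      1 - (κ : ℂ) • (modulusLaplacian A).map Complex.ofRealHom := by
    ext i j
    simp [modulusStepMatrix, Matrix.one_apply, apply_ite]
  rw [SemiconjBy, hmap, stepMatrix, mul_sub, sub_mul, mul_one, one_mul, Matrix.mul_smul,
    Matrix.smul_mul, hlap]

theorem IsCircleNullVector.stepMatrix_pow_apply (hζ : IsCircleNullVector A ζ) (κ : ℝ) (k : ℕ)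
    (i j : Fin n) : (stepMatrix A κ ^ k) i j =
      ζ i * ((modulusStepMatrix A κ ^ k) i j : ℝ) * (ζ j : ℂ)⁻¹ := by
  have hpow := congrFun₂ ((hζ.semiconjBy_stepMatrix κ).pow_right k) i j
  rw [← Matrix.map_pow, circleDiag, Matrix.diagonal_mul, Matrix.mul_diagonal] at hpow
  exact (eq_mul_inv_iff_mul_eq₀ (Circle.coe_ne_zero _)).2 hpow.symm

end StepMatrix

section Convergence

variable {n : ℕ} {A : Matrix (Fin n) (Fin n) ℂ} {κ : ℝ} {ζ : Fin n → Circle} {ν : Fin n → ℝ}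

theorem exists_isNormalizedLeftNullVector [NeZero n] (hκ : 0 < κ)
    (hκd : ∀ i, κ * modulusDegree A i ≤ 1) (hζ : IsCircleNullVector A ζ) :
    ∃ ν, IsNormalizedLeftNullVector A ζ ν := by
  obtain ⟨ν, hν, hνP⟩ :=
    exists_mem_stdSimplex_vecMul_eq (modulusStepMatrix_mem_rowStochastic hκ.le hκd)
  exact ⟨ν, hζ.isNormalizedLeftNullVector_iff.2
    ⟨hν, (vecMul_modulusStepMatrix_eq_iff hκ.ne').1 hνP⟩⟩

theorem tendsto_stepMatrix_pow (hκ : 0 < κ) (hκd : ∀ i, κ * modulusDegree A i < 1)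
    (htree : HasSpanningTree (graph A)) (hζ : IsCircleNullVector A ζ)
    (hν : IsNormalizedLeftNullVector A ζ ν) :
    Tendsto (stepMatrix A κ ^ ·) atTop
      (𝓝 (Matrix.vecMulVec (fun i => (ζ i : ℂ)) (leftVector ζ ν))) := by
  obtain ⟨hνsimplex, hνL⟩ := hζ.isNormalizedLeftNullVector_iff.1 hν
  have hreal := tendsto_pow_apply_of_vecMul_eq
    (modulusStepMatrix_mem_rowStochastic hκ.le fun i => (hκd i).le)
    (modulusStepMatrix_apply_self_pos hκ.le hκd)
    (htree.mono fun _ _ => modulusStepMatrix_apply_pos_of_adj hκ fun i => (hκd i).le)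
    hνsimplex.2 ((vecMul_modulusStepMatrix_eq_iff hκ.ne').2 hνL)
  refine tendsto_pi_nhds.2 fun i => tendsto_pi_nhds.2 fun j => ?_
  simp only [hζ.stepMatrix_pow_apply, Matrix.vecMulVec_apply, leftVector_apply,
    mul_comm (ζ j : ℂ)⁻¹, ← mul_assoc]
  exact (((Complex.continuous_ofReal.tendsto _).comp (hreal i j)).const_mul _).mul_const _

theorem IsTrajectory.tendsto (hκ : 0 < κ) (hκd : ∀ i, κ * modulusDegree A i < 1)
    (htree : HasSpanningTree (graph A)) (hζ : IsCircleNullVector A ζ)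
    (hν : IsNormalizedLeftNullVector A ζ ν) {z : ℕ → Fin n → ℂ} (hz : IsTrajectory A κ z) :
    Tendsto z atTop (𝓝 ((leftVector ζ ν ⬝ᵥ z 0) • (fun i => (ζ i : ℂ)))) := by
  have hcont : Continuous fun M : Matrix (Fin n) (Fin n) ℂ => M *ᵥ z 0 := by fun_prop
  have hlim := (hcont.tendsto _).comp (tendsto_stepMatrix_pow hκ hκd htree hζ hν)
  rw [Matrix.vecMulVec_mulVec, op_smul_eq_smul] at hlim
  exact hlim.congr fun k => (isTrajectory_iff_forall_pow.1 hz k).symm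

theorem ae_apply_ne_zero {E F : Type*} [NormedAddCommGroup E] [NormedSpace ℝ E]
    [FiniteDimensional ℝ E] [MeasurableSpace E] [BorelSpace E] [AddCommGroup F] [Module ℝ F]
    (μ : Measure E) [μ.IsAddHaarMeasure] {f : E →ₗ[ℝ] F} (hf : f ≠ 0) : ∀ᵐ x ∂μ, f x ≠ 0 := by
  have hker := Measure.addHaar_submodule μ (LinearMap.ker f) (mt LinearMap.ker_eq_top.1 hf)
  exact (measure_eq_zero_iff_ae_notMem.1 hker).mono fun x hx => by simpa using hx

theorem leftVector_dotProduct_circle (ζ : Fin n → Circle) (ν : Fin n → ℝ) :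
    leftVector ζ ν ⬝ᵥ (fun i => (ζ i : ℂ)) = ∑ i, ν i := by
  have hterm : ∀ i, leftVector ζ ν i * ζ i = ν i := fun i => by
    rw [leftVector_apply, mul_right_comm, inv_mul_cancel₀ (Circle.coe_ne_zero _), one_mul]
  simp only [dotProduct, hterm, Complex.ofReal_sum]

theorem reachesComplexConsensus_of_isCircleNullVector [NeZero n] (hκ : 0 < κ)
    (hκd : ∀ i, κ * modulusDegree A i < 1) (htree : HasSpanningTree (graph A))
    (hζ : IsCircleNullVector A ζ) : ReachesComplexConsensus A κ := by
  obtain ⟨ν, hν⟩ := exists_isNormalizedLeftNullVector hκ (fun i => (hκd i).le) hζ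
  have hηζ : leftVector ζ ν ⬝ᵥ (fun i => (ζ i : ℂ)) = 1 := by
    rw [leftVector_dotProduct_circle, (hζ.isNormalizedLeftNullVector_iff.1 hν).1.2,
      Complex.ofReal_one]
  have hη : dotProductBilin ℝ ℝ (leftVector ζ ν) ≠ 0 := fun h0 =>
    one_ne_zero (hηζ.symm.trans (LinearMap.congr_fun h0 _))
  filter_upwards [ae_apply_ne_zero volume hη] with z₀ hz₀ z hz hzz₀
  subst hzz₀
  refine ⟨‖leftVector ζ ν ⬝ᵥ z 0‖, norm_pos_iff.2 hz₀, fun i => ?_⟩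
  simpa [Circle.norm_coe] using (tendsto_pi_nhds.1 (hz.tendsto hκ hκd htree hζ hν) i).norm

end Convergence

section Necessity

theorem exists_eq_and_map_eq_of_tendsto {X Y : Type*} [TopologicalSpace X] [TopologicalSpace Y]
    [T2Space Y] {f : X → X} {g : X → Y} (hf : Continuous f) (hg : Continuous g) {x : ℕ → X}
    (hx : ∀ k, x (k + 1) = f (x k)) {K : Set X} (hK : IsCompact K)
    (hxK : ∃ᶠ k in atTop, x k ∈ K) {y : Y} (hy : Tendsto (g ∘ x) atTop (𝓝 y)) :
    ∃ w, g w = y ∧ g (f w) = y := by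
  obtain ⟨w, -, hw⟩ := hK.exists_mapClusterPt_of_frequently hxK
  obtain ⟨U, hU, hxU⟩ := mapClusterPt_iff_ultrafilter.1 hw
  have hy' : Tendsto (g ∘ f ∘ x) atTop (𝓝 y) :=
    (hy.comp (tendsto_add_atTop_nat 1)).congr fun k => congrArg g (hx k)
  exact ⟨w, tendsto_nhds_unique ((hg.tendsto w).comp hxU) (hy.mono_left hU),
    tendsto_nhds_unique (((hg.comp hf).tendsto w).comp hxU) (hy'.mono_left hU)⟩

variable {n : ℕ} {A : Matrix (Fin n) (Fin n) ℂ} {κ : ℝ} {ζ : Fin n → Circle}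
  {z : ℕ → Fin n → ℂ}

theorem norm_smul_sum_mul_le (hκ : 0 ≤ κ) {i : Fin n} {w : Fin n → ℂ} {ρ : ℝ}
    (hw : ∀ j, A i j ≠ 0 → ‖w j‖ ≤ ρ) :
    ‖κ • ∑ j, A i j * w j‖ ≤ κ * modulusDegree A i * ρ := by
  have hterm : ∀ j, ‖A i j * w j‖ ≤ ‖A i j‖ * ρ := fun j => by
    rw [norm_mul]
    by_cases hij : A i j = 0
    · simp [hij]
    · exact mul_le_mul_of_nonneg_left (hw j hij) (norm_nonneg _)
  rw [norm_smul, Real.norm_of_nonneg hκ, mul_assoc, modulusDegree, Finset.sum_mul]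
  exact mul_le_mul_of_nonneg_left (norm_sum_le_of_le _ fun j _ => hterm j) hκ

theorem stepMatrix_mulVec_eq_self_of_norm_eq (hκ : 0 ≤ κ) (hκd : ∀ i, κ * modulusDegree A i < 1)
    {a : ℝ} {w : Fin n → ℂ} (hw : ∀ i, ‖w i‖ = a) (hw' : ∀ i, ‖(stepMatrix A κ *ᵥ w) i‖ = a) :
    stepMatrix A κ *ᵥ w = w := by
  funext i
  have hnorm : ‖(stepMatrix A κ *ᵥ w) i‖ = ‖w i‖ := (hw' i).trans (hw i).symm
  rw [stepMatrix_mulVec_apply] at hnorm ⊢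
  refine smul_add_eq_of_norm_eq (sub_pos.2 (hκd i)) ?_ hnorm
  rw [sub_sub_cancel]
  exact norm_smul_sum_mul_le hκ fun j _ => ((hw j).trans (hw i).symm).le

theorem exists_isCircleNullVector_of_norm_eq {a : ℝ} (ha : 0 < a) {w : Fin n → ℂ}
    (hw : ∀ i, ‖w i‖ = a) (hLw : laplacian A *ᵥ w = 0) : ∃ ζ, IsCircleNullVector A ζ := by
  have hcircle : ∀ i, (a : ℂ)⁻¹ * w i ∈ Submonoid.unitSphere ℂ := fun i => by
    simp [Submonoid.unitSphere, hw, abs_of_pos ha, ha.ne']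
  refine ⟨fun i => ⟨(a : ℂ)⁻¹ * w i, hcircle i⟩, ?_⟩
  change laplacian A *ᵥ ((a : ℂ)⁻¹ • w) = 0
  rw [Matrix.mulVec_smul, hLw, smul_zero]

theorem ReachesComplexConsensus.exists_isCircleNullVector (hκ : 0 < κ)
    (hκd : ∀ i, κ * modulusDegree A i < 1) (h : ReachesComplexConsensus A κ) :
    ∃ ζ, IsCircleNullVector A ζ := by
  obtain ⟨z₀, hz₀⟩ := h.exists
  obtain ⟨z, hz, hzz₀⟩ := exists_isTrajectory A κ z₀
  obtain ⟨a, ha, hlim⟩ := hz₀ z hz hzz₀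
  have hball : ∀ᶠ k in atTop, z k ∈ Metric.closedBall (0 : Fin n → ℂ) (a + 1) := by
    filter_upwards [eventually_all.2 fun i => (hlim i).eventually_le_const (lt_add_one a)]
      with k hk
    rwa [mem_closedBall_zero_iff, pi_norm_le_iff_of_nonneg (by linarith)]
  obtain ⟨w, hw, hw'⟩ := exists_eq_and_map_eq_of_tendsto (f := (stepMatrix A κ *ᵥ ·))
    (g := fun w i => ‖w i‖) (by fun_prop) (by fun_prop)
    (fun k => (hz k).trans (stepMatrix_mulVec A κ _).symm) (isCompact_closedBall _ _)
    hball.frequently (y := fun _ => a) (tendsto_pi_nhds.2 hlim)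
  have hfixed := stepMatrix_mulVec_eq_self_of_norm_eq hκ.le hκd (congrFun hw) (congrFun hw')
  rw [stepMatrix_mulVec, sub_eq_self, smul_eq_zero_iff_right (Complex.ofReal_ne_zero.2 hκ.ne')]
    at hfixed
  exact exists_isCircleNullVector_of_norm_eq ha (congrFun hw) hfixed

theorem IsTrajectory.norm_le_of_predecessor_closed (hκ : 0 ≤ κ)
    (hκd : ∀ i, κ * modulusDegree A i ≤ 1) (hz : IsTrajectory A κ z) {S : Set (Fin n)}
    (hS : ∀ ⦃i j⦄, i ∈ S → (graph A).Adj j i → j ∈ S) {ρ : ℝ} (hρ : ∀ i ∈ S, ‖z 0 i‖ ≤ ρ)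
    (k : ℕ) : ∀ i ∈ S, ‖z k i‖ ≤ ρ := by
  induction k with
  | zero => exact hρ
  | succ k ih =>
    intro i hi
    have hself : ‖(1 - κ * modulusDegree A i) • z k i‖ ≤ (1 - κ * modulusDegree A i) * ρ := by
      rw [norm_smul, Real.norm_of_nonneg (sub_nonneg.2 (hκd i))]
      exact mul_le_mul_of_nonneg_left (ih i hi) (sub_nonneg.2 (hκd i))
    rw [hz, ← stepMatrix_mulVec, stepMatrix_mulVec_apply]
    calc _ ≤ (1 - κ * modulusDegree A i) * ρ + κ * modulusDegree A i * ρ :=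
          norm_add_le_of_le hself (norm_smul_sum_mul_le hκ fun j hij => ih j (hS hi hij))
      _ = ρ := by ring

theorem IsTrajectory.sub_circle (hz : IsTrajectory A κ z) (hζ : IsCircleNullVector A ζ) :
    IsTrajectory A κ fun k => z k - fun i => (ζ i : ℂ) := fun k => by
  dsimp only
  rw [hz k, Matrix.mulVec_sub, hζ, sub_zero, sub_right_comm]

theorem ReachesComplexConsensus.hasSpanningTree [NeZero n] (hκ : 0 ≤ κ)
    (hκd : ∀ i, κ * modulusDegree A i ≤ 1) (h : ReachesComplexConsensus A κ)
    (hζ : IsCircleNullVector A ζ) : HasSpanningTree (graph A) := by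
  classical
  by_contra hno
  obtain ⟨v, w, hvw⟩ := exists_disjoint_ancestors_of_not_hasSpanningTree hno
  let c : Fin n → ℂ := fun i => if Relation.ReflTransGen (graph A).Adj i v then ζ i else 0
  obtain ⟨z₀, hz₀, hdist⟩ :=
    (Measure.dense_of_ae h).exists_dist_lt c (by norm_num : (0 : ℝ) < 1 / 4)
  obtain ⟨z, hz, rfl⟩ := exists_isTrajectory A κ z₀
  obtain ⟨a, -, hlim⟩ := hz₀ z hz rfl
  have hinit : ∀ i, ‖z 0 i - c i‖ ≤ 1 / 4 := fun i =>
    (norm_le_pi_norm (z 0 - c) i).trans (by rw [← dist_eq_norm, dist_comm]; exact hdist.le)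
  have hclosed : ∀ x ⦃i j⦄, Relation.ReflTransGen (graph A).Adj i x → (graph A).Adj j i →
      Relation.ReflTransGen (graph A).Adj j x := fun x i j hi hji => .head hji hi
  have hnear_circle : ∀ k, ‖z k v - ζ v‖ ≤ 1 / 4 := fun k =>
    (hz.sub_circle hζ).norm_le_of_predecessor_closed hκ hκd (hclosed v)
      (fun i hi => (congrArg (‖z 0 i - ·‖) (if_pos hi)).symm.trans_le (hinit i)) k v .refl
  have hnear_zero : ∀ k, ‖z k w‖ ≤ 1 / 4 := fun k =>
    hz.norm_le_of_predecessor_closed hκ hκd (hclosed w)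
      (fun i hi => by
        have hi0 : c i = 0 := if_neg (Set.disjoint_right.1 hvw hi)
        simpa only [hi0, sub_zero] using hinit i) k w .refl
  have hge : 3 / 4 ≤ a := ge_of_tendsto' (hlim v) fun k => by
    have htriangle : ‖(ζ v : ℂ)‖ - ‖z k v‖ ≤ ‖z k v - ζ v‖ := by
      rw [norm_sub_rev]
      exact norm_sub_norm_le _ _
    rw [Circle.norm_coe] at htriangle
    linarith [hnear_circle k]
  have hle : a ≤ 1 / 4 := le_of_tendsto' (hlim w) hnear_zero
  linarith

end Necessity

end ComplexConsensus

open ComplexConsensus in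
theorem mainTheorem2_general {n : ℕ} [NeZero n] (A : Matrix (Fin n) (Fin n) ℂ) (κ : ℝ)
    (hκ : 0 < κ) (hκΔ : maxModulusDegree A ≠ 0 → κ < 1 / maxModulusDegree A) :
    (ReachesComplexConsensus A κ ↔ EssentiallyNonnegative A ∧ HasSpanningTree (graph A)) ∧
    (EssentiallyNonnegative A → HasSpanningTree (graph A) →
      (∃ (ζ : Fin n → Circle) (ν : Fin n → ℝ),
        IsCircleNullVector A ζ ∧ IsNormalizedLeftNullVector A ζ ν) ∧
      ∀ (ζ : Fin n → Circle) (ν : Fin n → ℝ),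
        IsCircleNullVector A ζ → IsNormalizedLeftNullVector A ζ ν →
        ∀ z : ℕ → Fin n → ℂ, IsTrajectory A κ z →
          Tendsto z atTop (𝓝 ((leftVector ζ ν ⬝ᵥ z 0) • (fun i => (ζ i : ℂ))))) := by
  have hκd : ∀ i, κ * modulusDegree A i < 1 := mul_modulusDegree_lt_one hκ hκΔ
  rw [essentiallyNonnegative_iff_exists_isCircleNullVector]
  refine ⟨⟨fun hconsensus => ?_, ?_⟩, ?_⟩
  · obtain ⟨ζ, hζ⟩ := hconsensus.exists_isCircleNullVector hκ hκd
    exact ⟨⟨ζ, hζ⟩, hconsensus.hasSpanningTree hκ.le (fun i => (hκd i).le) hζ⟩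
  · rintro ⟨⟨ζ, hζ⟩, htree⟩
    exact reachesComplexConsensus_of_isCircleNullVector hκ hκd htree hζ
  · rintro ⟨ζ, hζ⟩ htree
    obtain ⟨ν, hν⟩ := exists_isNormalizedLeftNullVector hκ (fun i => (hκd i).le) hζ
    exact ⟨⟨ζ, ν, hζ, hν⟩, fun ζ ν hζ hν z hz => hz.tendsto hκ hκd htree hζ hν⟩

theorem mainTheorem2 {n : ℕ} [NeZero n] (A : Matrix (Fin n) (Fin n) ℂ) (hA : ∀ i, A i i = 0)
    (κ : ℝ) (hκ : 0 < κ)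
    -- `κ < 1 / Δ`, where `1 / Δ` is read as `+∞` if `Δ = 0`
    (hκΔ : ComplexConsensus.maxModulusDegree A ≠ 0 →
      κ < 1 / ComplexConsensus.maxModulusDegree A) :
    (ComplexConsensus.ReachesComplexConsensus A κ ↔
      ComplexConsensus.EssentiallyNonnegative A ∧
        ComplexConsensus.HasSpanningTree (ComplexConsensus.graph A)) ∧
    (ComplexConsensus.EssentiallyNonnegative A →
      ComplexConsensus.HasSpanningTree (ComplexConsensus.graph A) →
      (∃ (ζ : Fin n → Circle) (ν : Fin n → ℝ),
        ComplexConsensus.IsCircleNullVector A ζ ∧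
        ComplexConsensus.IsNormalizedLeftNullVector A ζ ν) ∧
      ∀ (ζ : Fin n → Circle) (ν : Fin n → ℝ),
        ComplexConsensus.IsCircleNullVector A ζ →
        ComplexConsensus.IsNormalizedLeftNullVector A ζ ν →
        ∀ z : ℕ → Fin n → ℂ, ComplexConsensus.IsTrajectory A κ z →
          Tendsto z atTop
            (𝓝 ((ComplexConsensus.leftVector ζ ν ⬝ᵥ z 0) • (fun i => (ζ i : ℂ))))) :=
  mainTheorem2_general A κ hκ hκΔ
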